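/- Let $m,d\in\mathbb{N}$, let $\mathcal{A}=\mathbb{C}^{m\times m}$ be the $C^*$-algebra of complex $m\times m$ matrices with the operator norm, and let $\mathcal{X}=\mathbb{R}^d$ with the Euclidean norm. For $c\in\mathcal{A}$ write $c\ge_{\mathcal{A}}0$ if $c$ is positive (positive semidefinite) and $c>_{\mathcal{A}}0$ if $c$ is positive and invertible. Let $\eta$ be a countably additive $\mathcal{A}$-valued Borel measure on $[0,\infty)$ that is positive, i.e. $\eta(E)\ge_{\mathcal{A}}0$ for every Borel set $E\subseteq[0,\infty)$, and put $$\operatorname{supp}(\eta)=\{t\in[0,\infty)\mid \eta(U)>_{\mathcal{A}}0\text{ for every open }U\subseteq[0,\infty)\text{ with }t\in U\}.$$ Let $k:\mathcal{X}\times\mathcal{X}\to\mathcal{A}$ be the radial kernel given by $\eta$: $k$ is an $\mathcal{A}$-valued positive definite kernel (that is, $k(x,y)=k(y,x)^*$ and $\sum_{i,j=1}^n c_i^*k(x_i,x_j)c_j\ge_{\mathcal{A}}0$ for all $n$, $c_i\in\mathcal{A}$, $x_i\in\mathcal{X}$) with $$k(x,y)=\int_{[0,\infty)}e^{-t\|x-y\|^2}\,d\eta(t)\qquad(x,y\in\mathcal{X}).$$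 Let $\phi(x)=k(\cdot,x)$, and let $\mathcal{M}_k$ be the reproducing kernel Hilbert $\mathcal{A}$-module of $k$, i.e. the completion of $\{\sum_{i=1}^n\phi(x_i)c_i\mid n\in\mathbb{N},\,x_i\in\mathcal{X},\,c_i\in\mathcal{A}\}$ in the norm $\|u\|=\|\langle u,u\rangle\|_{\mathcal{A}}^{1/2}$ given by the $\mathcal{A}$-valued inner product $\langle\sum_i\phi(x_i)c_i,\sum_j\phi(y_j)d_j\rangle=\sum_{i,j}c_i^*k(x_i,y_j)d_j$. Let $\mathcal{D}(\mathcal{X},\mathcal{A})$ be the set of all countably additive $\mathcal{A}$-valued Borel measures $\mu$ on $\mathcal{X}$ that are finite (of finite total variation $|\mu|$) and regular (for every Borel set $E$ and $\varepsilon>0$ there are a compact $K\subseteq E$ and an open $G\supseteq E$ with $\|\mu(F)\|_{\mathcal{A}}\le\varepsilon$ for every Borel set $F\subseteq G\setminus K$). If $\operatorname{supp}(\eta)$ is nonempty and $\operatorname{supp}(\eta)\ne\{0\}$, then $\phi$ is Bochner integrable with respect to $|\mu|$ for every $\mu\in\mathcal{D}(\mathcal{X},\mathcal{A})$, so that the kernel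 mean embedding $$\Phi:\mathcal{D}(\mathcal{X},\mathcal{A})\to\mathcal{M}_k,\qquad \Phi(\mu)=\int_{\mathcal{X}}\phi(x)\,d\mu(x)$$ is well defined, and $\Phi$ is injective. -/

import Mathlib

open MeasureTheory
open scoped NNReal ENNReal ComplexOrder

noncomputable section

/-- An `A`-valued positive definite kernel on `X`. -/
structure PosDefKernel (X A : Type*) [CStarAlgebra A] [PartialOrder A] where
  toFun : X → X → A
  star_swap : ∀ x y, star (toFun y x) = toFun x y
  nonneg : ∀ (n : ℕ) (c : Fin n → A) (x : Fin n → X),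
    0 ≤ ∑ i, ∑ j, star (c i) * toFun (x i) (x j) * c j

namespace PosDefKernel

variable {X A : Type*} [CStarAlgebra A] [PartialOrder A]

instance : CoeFun (PosDefKernel X A) (fun _ => X → X → A) := ⟨PosDefKernel.toFun⟩

/-- Formal finite sums `∑ φ(x) c_x`.  Such a sum stands for the function
`y ↦ ∑ k(y,x) c_x`; two formal sums are at distance zero from each other exactly when they
stand for the same function (`PosDefKernel.norm_eq_zero_iff`), so that this seminormed module and
the inner product module of these functions have the same completion. -/
def PreRKHM (_k : PosDefKernel X A) : Type _ := X →₀ A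

variable (k : PosDefKernel X A)

instance : AddCommGroup k.PreRKHM := inferInstanceAs (AddCommGroup (X →₀ A))
instance : Module ℂ k.PreRKHM := inferInstanceAs (Module ℂ (X →₀ A))
instance : Module Aᵐᵒᵖ k.PreRKHM := inferInstanceAs (Module Aᵐᵒᵖ (X →₀ A))

/-- The coefficients `c_x` of a formal sum. -/
def coeffs (u : k.PreRKHM) : X →₀ A := u

/-- The formal sum `φ(x) c`. -/
def single (x : X) (c : A) : k.PreRKHM := (Finsupp.single x c : X →₀ A)

theorem coeffs_add (u v : k.PreRKHM) : k.coeffs (u + v) = k.coeffs u + k.coeffs v := rfl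
theorem coeffs_smul (z : ℂ) (u : k.PreRKHM) : k.coeffs (z • u) = z • k.coeffs u := rfl
theorem coeffs_op_smul (c : Aᵐᵒᵖ) (u : k.PreRKHM) : k.coeffs (c • u) = c • k.coeffs u := rfl
theorem coeffs_single (x : X) (c : A) : k.coeffs (k.single x c) = Finsupp.single x c := rfl

/-- The function `y ↦ ∑ k(y,x) c_x` that a formal sum stands for. -/
def toFunction (u : k.PreRKHM) (y : X) : A := (k.coeffs u).sum fun x a => k y x * a

/-- `⟨∑ φ(x_i) c_i, ∑ φ(y_j) d_j⟩ = ∑ c_i^* k(x_i,y_j) d_j`. -/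
instance : Inner A k.PreRKHM where
  inner u v := (k.coeffs u).sum fun x a => (k.coeffs v).sum fun y b => star a * k x y * b

theorem inner_def (u v : k.PreRKHM) : inner A u v =
    (k.coeffs u).sum fun x a => (k.coeffs v).sum fun y b => star a * k x y * b := rfl

theorem inner_eq (u v : k.PreRKHM) :
    inner A u v = (k.coeffs u).sum fun x a => star a * k.toFunction v x := by
  simp only [inner_def, toFunction, Finsupp.sum, Finset.mul_sum, mul_assoc]

theorem inner_add_right (u v w : k.PreRKHM) :
    inner A u (v + w) = inner A u v + inner A u w := by
  have h : ∀ x, k.toFunction (v + w) x = k.toFunction v x + k.toFunction w x := fun x =>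
    Finsupp.sum_add_index' (by simp) (by simp [mul_add])
  simp [inner_eq, h, mul_add, Finsupp.sum_add]

theorem star_inner (u v : k.PreRKHM) : star (inner A u v) = inner A v u := by
  rw [inner_def, inner_def, Finsupp.sum_comm]
  simp only [Finsupp.sum, star_sum, star_mul, star_star, k.star_swap, mul_assoc]

theorem inner_add_left (u v w : k.PreRKHM) :
    inner A (u + v) w = inner A u w + inner A v w := by
  rw [← k.star_inner, inner_add_right, star_add, k.star_inner, k.star_inner]

theorem inner_smul_right (u v : k.PreRKHM) (z : ℂ) : inner A u (z • v) = z • inner A u v := by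
  have h : ∀ x, k.toFunction (z • v) x = z • k.toFunction v x := fun x => by
    rw [toFunction, coeffs_smul, Finsupp.sum_smul_index' (by simp), toFunction, Finsupp.smul_sum]
    simp
  simp [inner_eq, h, Finsupp.smul_sum]

theorem inner_op_smul_right (u v : k.PreRKHM) (c : A) :
    inner A u (MulOpposite.op c • v) = inner A u v * c := by
  have h : ∀ x, k.toFunction (MulOpposite.op c • v) x = k.toFunction v x * c := fun x => by
    rw [toFunction, coeffs_op_smul, Finsupp.sum_smul_index' (by simp), toFunction,
      Finsupp.sum_mul]
    simp [mul_assoc]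
  simp [inner_eq, h, Finsupp.sum_mul, mul_assoc]

theorem inner_op_smul_left (u v : k.PreRKHM) (c : A) :
    inner A (MulOpposite.op c • u) v = star c * inner A u v := by
  rw [← k.star_inner, inner_op_smul_right, star_mul, k.star_inner]

theorem inner_smul_left (u v : k.PreRKHM) (z : ℂ) :
    inner A (z • u) v = star z • inner A u v := by
  rw [← k.star_inner, inner_smul_right, star_smul, k.star_inner]

theorem inner_single_left (x : X) (u : k.PreRKHM) :
    inner A (k.single x 1) u = k.toFunction u x := by
  rw [inner_eq, coeffs_single, Finsupp.sum_single_index (by simp)]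
  simp

theorem inner_self_nonneg (u : k.PreRKHM) : 0 ≤ inner A u u := by
  set w : X →₀ A := k.coeffs u with hw
  let e := w.support.equivFin.symm
  have h := k.nonneg _ (fun i => w (e i)) (fun i => (e i : X))
  have h2 : inner A u u = ∑ x : w.support, ∑ y : w.support, star (w x) * k x y * w y := by
    rw [Finset.sum_coe_sort w.support (fun x => ∑ y : w.support, star (w x) * k x y * w y)]
    refine Finset.sum_congr rfl fun x _ => ?_
    rw [Finset.sum_coe_sort w.support (fun y => star (w x) * k x y * w y)]
    rfl
  rw [h2, ← e.sum_comp]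
  simp_rw [← e.sum_comp (fun y => star (w _) * k _ y * w y)]
  exact h

instance : Norm k.PreRKHM where
  norm u := √‖inner A u u‖

theorem norm_def (u : k.PreRKHM) : ‖u‖ = √‖inner A u u‖ := rfl

theorem norm_sq (u : k.PreRKHM) : ‖u‖ ^ 2 = ‖inner A u u‖ := by
  rw [norm_def, Real.sq_sqrt (norm_nonneg _)]

theorem pre_norm_nonneg (u : k.PreRKHM) : 0 ≤ ‖u‖ := Real.sqrt_nonneg _

theorem norm_op_smul_le (u : k.PreRKHM) (c : A) : ‖MulOpposite.op c • u‖ ≤ ‖u‖ * ‖c‖ := by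
  refine abs_le_of_sq_le_sq' ?_ (mul_nonneg (k.pre_norm_nonneg u) (norm_nonneg c)) |>.2
  rw [norm_sq, mul_pow, norm_sq, inner_op_smul_left, inner_op_smul_right]
  refine (norm_mul_le _ _).trans ?_
  rw [norm_star]
  have := norm_mul_le (inner A u u : A) c
  nlinarith [norm_nonneg c]

variable [StarOrderedRing A]

theorem norm_inner_le (u v : k.PreRKHM) : ‖inner A u v‖ ≤ ‖u‖ * ‖v‖ := by
  set a : A := inner A u v with ha
  have hau : inner A v u = star a := by rw [ha, k.star_inner]
  have key : ∀ t : ℝ, 0 < t → ‖inner A u u‖ ≤ t → ‖a‖ ^ 2 ≤ t * ‖inner A v v‖ := by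
    intro t ht hut
    have h1 : star a * inner A u u * a ≤ t • (star a * a) := by
      refine (CStarAlgebra.star_left_conjugate_le_norm_smul
        (b := inner A u u) (hb := .of_nonneg (k.inner_self_nonneg u))).trans ?_
      exact smul_le_smul_of_nonneg_right hut (star_mul_self_nonneg a)
    have h2 : ∀ r : ℝ, inner A (MulOpposite.op a • u + (r : ℂ) • v)
        (MulOpposite.op a • u + (r : ℂ) • v) =
        star a * inner A u u * a + (2 * r) • (star a * a) + (r * r) • inner A v v := by
      intro r
      have e1 : ∀ b : A, ((r : ℂ)) • b = r • b := fun b => rfl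
      simp only [inner_add_left, inner_add_right, inner_op_smul_right, inner_op_smul_left,
        inner_smul_left, inner_smul_right, hau, ← ha]
      simp only [RCLike.star_def, Complex.conj_ofReal, e1, smul_mul_assoc, two_mul, add_smul,
        add_mul, smul_smul, smul_add]
      abel
    have h0 := k.inner_self_nonneg (MulOpposite.op a • u + ((-t : ℝ) : ℂ) • v)
    rw [h2, mul_neg, neg_smul, neg_mul_neg, ← sub_eq_add_neg] at h0
    have h3 : t • (star a * a) ≤ t • (t • inner A v v) := by
      rw [smul_smul]
      have h4 : 0 ≤ t • (star a * a) - (2 * t) • (star a * a) + (t * t) • inner A v v :=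
        h0.trans (by gcongr)
      have h5 : t • (star a * a) - (2 * t) • (star a * a) + (t * t) • inner A v v
        = (t * t) • inner A v v - t • (star a * a) := by
        rw [two_mul, add_smul]; abel
      rwa [h5, sub_nonneg] at h4
    have h6 : star a * a ≤ t • inner A v v := (smul_le_smul_iff_of_pos_left ht).mp h3
    have h7 := CStarAlgebra.norm_le_norm_of_nonneg_of_le (star_mul_self_nonneg a) h6
    rwa [CStarRing.norm_star_mul_self, norm_smul, Real.norm_of_nonneg ht.le, ← sq] at h7
  have h8 : ‖a‖ ^ 2 ≤ ‖inner A u u‖ * ‖inner A v v‖ := by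
    refine le_of_forall_pos_le_add fun ε hε => ?_
    have hd : 0 < ‖inner A v v‖ + 1 := by positivity
    have hq : 0 < ε / (‖inner A v v‖ + 1) := by positivity
    refine (key (‖inner A u u‖ + ε / (‖inner A v v‖ + 1)) (by positivity) (by linarith)).trans ?_
    rw [add_mul]
    gcongr
    rw [div_mul_eq_mul_div, div_le_iff₀ hd]
    nlinarith
  refine abs_le_of_sq_le_sq' ?_ (mul_nonneg (k.pre_norm_nonneg u) (k.pre_norm_nonneg v)) |>.2
  rwa [mul_pow, norm_sq, norm_sq]

theorem seminormCore : SeminormedSpace.Core ℂ k.PreRKHM where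
  norm_nonneg u := k.pre_norm_nonneg u
  norm_smul z u := by
    simp only [norm_def, inner_smul_left, inner_smul_right, norm_smul, norm_star, ← mul_assoc]
    rw [Real.sqrt_mul (by positivity), Real.sqrt_mul_self (norm_nonneg _)]
  norm_triangle u v := by
    refine abs_le_of_sq_le_sq' ?_ (add_nonneg (k.pre_norm_nonneg u) (k.pre_norm_nonneg v)) |>.2
    rw [norm_sq, inner_add_left, inner_add_right, inner_add_right]
    have h1 := k.norm_inner_le u v
    have h2 := k.norm_inner_le v u
    have h3 := norm_add_le (inner A u u + inner A u v : A) (inner A v u + inner A v v)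
    have h4 := norm_add_le (inner A u u : A) (inner A u v)
    have h5 := norm_add_le (inner A v u : A) (inner A v v)
    rw [← norm_sq] at h4 h5
    nlinarith

instance : SeminormedAddCommGroup k.PreRKHM := SeminormedAddCommGroup.ofCore k.seminormCore
instance : NormedSpace ℂ k.PreRKHM where
  norm_smul_le z u := (k.seminormCore.norm_smul z u).le

theorem norm_eq_zero_iff (u : k.PreRKHM) : ‖u‖ = 0 ↔ k.toFunction u = 0 := by
  constructor
  · intro h
    ext x
    have := k.norm_inner_le (k.single x 1) u
    rw [h, mul_zero, inner_single_left] at this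
    exact norm_le_zero_iff.mp this
  · intro h
    have h0 : (inner A u u : A) = 0 := by
      rw [inner_eq, h]
      simp [Finsupp.sum]
    rw [norm_def, h0]
    simp

/-- The reproducing kernel Hilbert `A`-module of `k`, the completion of the module of the
functions `∑ φ(x_i) c_i`. -/
def RKHM : Type _ := UniformSpace.Completion k.PreRKHM

instance : NormedAddCommGroup k.RKHM :=
  inferInstanceAs (NormedAddCommGroup (UniformSpace.Completion k.PreRKHM))
instance : NormedSpace ℂ k.RKHM :=
  inferInstanceAs (NormedSpace ℂ (UniformSpace.Completion k.PreRKHM))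
instance : CompleteSpace k.RKHM :=
  inferInstanceAs (CompleteSpace (UniformSpace.Completion k.PreRKHM))

/-- The canonical map of the formal sums to the RKHM. -/
def toRKHM : k.PreRKHM →L[ℂ] k.RKHM := UniformSpace.Completion.toComplL

theorem denseRange_toRKHM : DenseRange k.toRKHM := UniformSpace.Completion.denseRange_coe

theorem isUniformInducing_toRKHM : IsUniformInducing k.toRKHM :=
  UniformSpace.Completion.isUniformInducing_coe _

theorem norm_toRKHM (u : k.PreRKHM) : ‖k.toRKHM u‖ = ‖u‖ := UniformSpace.Completion.norm_coe u

/-- The feature map `φ(x) = k(·, x)`. -/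
def feature (x : X) : k.RKHM := k.toRKHM (k.single x 1)

/-- The `A`-valued inner product of the RKHM, extended by continuity. -/
instance : Inner A k.RKHM :=
  inferInstanceAs (Inner A (UniformSpace.Completion k.PreRKHM))

/-- The right multiplication `(u, c) ↦ u c` on formal sums. -/
def preRightMul : k.PreRKHM →L[ℂ] A →L[ℂ] k.RKHM :=
  LinearMap.mkContinuous₂
    (LinearMap.mk₂ ℂ (fun u c => k.toRKHM (MulOpposite.op c • u))
      (fun u v c => by rw [smul_add, map_add])
      (fun z u c => by
        rw [← map_smul]
        congr 1
        exact smul_comm (M := Aᵐᵒᵖ) (N := ℂ) (α := X →₀ A) _ _ _)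
      (fun u c d => by rw [MulOpposite.op_add, add_smul, map_add])
      (fun z u c => by
        rw [← map_smul]
        congr 1
        rw [MulOpposite.op_smul]
        exact smul_assoc (M := ℂ) (N := Aᵐᵒᵖ) (α := X →₀ A) _ _ _))
    1 (fun u c => by
      rw [one_mul]
      exact (k.norm_toRKHM _).trans_le (k.norm_op_smul_le u c))

/-- The right multiplication `(u, c) ↦ u c` of the RKHM, extended by continuity. -/
def rightMul : k.RKHM →L[ℂ] A →L[ℂ] k.RKHM := k.preRightMul.extend k.toRKHM

theorem rightMul_toRKHM (u : k.PreRKHM) (c : A) :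
    k.rightMul (k.toRKHM u) c = k.toRKHM (MulOpposite.op c • u) := by
  rw [rightMul, ContinuousLinearMap.extend_eq _ k.denseRange_toRKHM k.isUniformInducing_toRKHM]
  rfl

theorem continuous_pre_inner :
    Continuous (fun p : k.PreRKHM × k.PreRKHM => (inner A p.1 p.2 : A)) := by
  let B : k.PreRKHM →L⋆[ℂ] k.PreRKHM →L[ℂ] A :=
    LinearMap.mkContinuous₂
      (LinearMap.mk₂'ₛₗ (starRingEnd ℂ) (RingHom.id ℂ) (fun u v : k.PreRKHM => (inner A u v : A))
        (fun u v w => k.inner_add_left u v w) (fun z u v => k.inner_smul_left u v z)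
        (fun u v w => k.inner_add_right u v w) (fun z u v => k.inner_smul_right u v z))
      1 (fun u v => by rw [one_mul]; exact k.norm_inner_le u v)
  have : Continuous fun p : k.PreRKHM × k.PreRKHM => B p.1 p.2 := by fun_prop
  exact this

theorem continuous_inner :
    Continuous (fun p : k.RKHM × k.RKHM => (inner A p.1 p.2 : A)) := by
  let B : k.PreRKHM →+ k.PreRKHM →+ A :=
    AddMonoidHom.mk' (fun u => AddMonoidHom.mk' (fun v => inner A u v) (k.inner_add_right u))
      (fun u v => by ext w; exact k.inner_add_left u v w)
  have hB : Continuous fun p : k.PreRKHM × k.PreRKHM => B p.1 p.2 := k.continuous_pre_inner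
  exact (UniformSpace.Completion.isDenseInducing_toCompl k.PreRKHM).extend_Z_bilin
    (UniformSpace.Completion.isDenseInducing_toCompl k.PreRKHM) hB

theorem inner_toRKHM (u v : k.PreRKHM) :
    (inner A (k.toRKHM u) (k.toRKHM v) : A) = inner A u v :=
  (UniformSpace.Completion.isDenseInducing_coe.prodMap
    UniformSpace.Completion.isDenseInducing_coe).extend_eq k.continuous_pre_inner (u, v)

theorem inner_feature (x y : X) : (inner A (k.feature x) (k.feature y) : A) = k x y := by
  rw [feature, feature, inner_toRKHM, inner_single_left, toFunction, coeffs_single,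
    Finsupp.sum_single_index (by simp), mul_one]

theorem norm_sq_rkhm (u : k.RKHM) : ‖u‖ ^ 2 = ‖(inner A u u : A)‖ := by
  refine k.denseRange_toRKHM.induction_on u (isClosed_eq (by fun_prop) ?_) fun v => ?_
  · exact (k.continuous_inner.comp (continuous_id.prodMk continuous_id)).norm
  · rw [inner_toRKHM, norm_toRKHM, norm_sq]

theorem inner_rightMul (u v : k.RKHM) (c : A) :
    (inner A u (k.rightMul v c) : A) = inner A u v * c := by
  refine k.denseRange_toRKHM.induction_on₂ (p := fun u v => (inner A u (k.rightMul v c) : A) =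
    inner A u v * c) (isClosed_eq ?_ ?_) (fun u v => ?_) u v
  · have h : Continuous fun p : k.RKHM × k.RKHM => k.rightMul p.2 c :=
      (k.rightMul.flip c).continuous.comp continuous_snd
    exact k.continuous_inner.comp (continuous_fst.prodMk h)
  · exact k.continuous_inner.mul continuous_const
  · rw [rightMul_toRKHM, inner_toRKHM, inner_toRKHM, inner_op_smul_right]

end PosDefKernel

/-- The `A`-valued measure `μ` is finite, i.e. of finite total variation, and regular. -/
def IsFiniteRegular {X A : Type*} [TopologicalSpace X] [MeasurableSpace X] [NormedAddCommGroup A]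
    (μ : VectorMeasure X A) : Prop :=
  μ.variation Set.univ < ∞ ∧
    ∀ E : Set X, MeasurableSet E → ∀ ε : ℝ, 0 < ε →
      ∃ K G : Set X, IsCompact K ∧ IsOpen G ∧ K ⊆ E ∧ E ⊆ G ∧
        ∀ F : Set X, MeasurableSet F → F ⊆ G \ K → ‖μ F‖ ≤ ε

/-- `D(X, A)`: the `A`-valued finite regular Borel measures on `X`. -/
abbrev FiniteRegularMeasure (X A : Type*) [TopologicalSpace X] [MeasurableSpace X] [BorelSpace X]
    [NormedAddCommGroup A] : Type _ :=
  {μ : VectorMeasure X A // IsFiniteRegular μ}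

/-- The kernel mean embedding `Φ(μ) = ∫ φ(x) dμ(x)`, an integral in the RKHM: the integral of the
step function `∑ u_i 1_{E_i}` is `∑ u_i μ(E_i)`, with the right multiplication of the RKHM. -/
def kernelMeanEmbedding {X A : Type*} [TopologicalSpace X] [MeasurableSpace X] [BorelSpace X]
    [CStarAlgebra A] [PartialOrder A] [StarOrderedRing A] (k : PosDefKernel X A)
    (μ : FiniteRegularMeasure X A) : k.RKHM :=
  μ.1.integral k.feature (k.rightMul.bilinearRestrictScalars ℝ)

/-- An `A`-valued measure is positive if all its values are positive elements of `A`. -/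
def IsPositiveMeasure {X A : Type*} [MeasurableSpace X] [CStarAlgebra A] [PartialOrder A]
    (η : VectorMeasure X A) : Prop :=
  ∀ E : Set X, MeasurableSet E → 0 ≤ η E

/-- The support of an `A`-valued measure: the points all of whose open neighbourhoods have
strictly positive, i.e. positive and invertible, measure. -/
def measureSupport {X A : Type*} [TopologicalSpace X] [MeasurableSpace X] [CStarAlgebra A]
    [PartialOrder A] (η : VectorMeasure X A) : Set X :=
  {x | ∀ U : Set X, IsOpen U → x ∈ U → IsStrictlyPositive (η U)}

/-- `k(x, y) = ∫_{[0,∞)} exp (-t ‖x - y‖²) dη(t)` for all `x` and `y`. -/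
def IsRadialWith {d : ℕ} {A : Type*} [CStarAlgebra A] [PartialOrder A]
    (k : PosDefKernel (EuclideanSpace ℝ (Fin d)) A) (η : VectorMeasure ℝ≥0 A) : Prop :=
  ∀ x y, k x y = η.integral (fun t : ℝ≥0 => Real.exp (-(t * ‖x - y‖ ^ 2)))
    (ContinuousLinearMap.lsmul ℝ ℝ)

end

/-!
Two measures with the same image under the kernel mean embedding `Φ` differ by a measure `ν` with
`Φ ν = 0`; the point is to show `ν = 0`. In finite dimension a vector measure has finite variation
and a density with respect to it (`exists_density_variation`, from the Radon–Nikodym theorem for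
signed measures), say `ν = h ρ` and `η = H τ`, and integrals of bounded functions against it are
Bochner integrals (`integral_eq_integral_density`). By the reproducing property,
`∫ k(y, x) h(x) dρ(x) = 0` for every `y`.

Multiplying by `h(y)^*` on the left and integrating in `y` gives
`∫_t ∬ exp (-t ‖y - x‖²) h(y)^* H(t) h(x) = 0`. The Gaussian is itself the Fourier transform of
a Gaussian, so that with the Fourier transform `W` of `h` the inner double integral is a positive
multiple of `∫ exp (-‖ξ‖²) W(2√t ξ)^* H(t) W(2√t ξ) dξ`
(`integral_gaussian_smul_star_fourier`). Composed with a positive functional `φ`, here the real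
part of the trace, this is nonnegative for almost every `t`, because `η` is positive
(`ae_forall_conj_nonneg`). Hence it vanishes for almost every `t`, and by continuity of `W`, for
almost every `t > 0`, `φ (W(ξ)^* H(t) W(ξ)) = 0` for all `ξ`. Integration over `(0, ∞)` gives
`φ (W(ξ)^* η((0, ∞)) W(ξ)) = 0` (`fourier_isotropic_of_integral_eq_zero`).

The hypothesis on the support supplies a support point `t ≠ 0`, which has the open neighbourhood
`(0, ∞)`, so `η((0, ∞))` is strictly positive. As `φ` is faithful, `W = 0`, and uniqueness of the
Fourier transform (`ae_eq_zero_of_charFun_eq_zero`) gives `h = 0` almost everywhere.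

The feature map `ψ(x) = k(·, x)` is integrable because it is continuous and bounded, by
`‖ψ(x) - ψ(y)‖² = ‖k(x, x) - k(x, y) - k(y, x) + k(y, y)‖` and `‖ψ(x)‖² = ‖k(x, x)‖`.
-/

/-! ### Vector measures with values in a finite-dimensional space -/

namespace MeasureTheory.VectorMeasure

variable {X E F G : Type*} {mX : MeasurableSpace X}
  [NormedAddCommGroup E] [NormedSpace ℝ E] [NormedAddCommGroup F] [NormedSpace ℝ F]
  [NormedAddCommGroup G] [NormedSpace ℝ G]

/-- The signed measure formed by the `i`-th coordinate of a vector measure with values in a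
finite-dimensional space. -/
noncomputable def coordMeasure [FiniteDimensional ℝ F] (μ : VectorMeasure X F)
    (i : Fin (Module.finrank ℝ F)) : SignedMeasure X :=
  μ.mapRange ((Module.finBasis ℝ F).coord i).toAddMonoidHom
    ((Module.finBasis ℝ F).coord i).continuous_of_finiteDimensional

theorem coordMeasure_apply [FiniteDimensional ℝ F] (μ : VectorMeasure X F)
    (i : Fin (Module.finrank ℝ F)) (s : Set X) :
    μ.coordMeasure i s = (Module.finBasis ℝ F).coord i (μ s) := rfl

theorem sum_coordMeasure_smul [FiniteDimensional ℝ F] (μ : VectorMeasure X F) (s : Set X) :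
    ∑ i, μ.coordMeasure i s • Module.finBasis ℝ F i = μ s :=
  (Module.finBasis ℝ F).sum_repr (μ s)

/-- Each coordinate is a signed measure, and signed measures have finite variation. -/
instance isFiniteMeasure_variation [FiniteDimensional ℝ F] (μ : VectorMeasure X F) :
    IsFiniteMeasure μ.variation := by
  have hi (i) : IsFiniteMeasure (μ.coordMeasure i).variation := by
    rw [← SignedMeasure.totalVariation_eq_variation]
    infer_instance
  have hle : μ.variation ≤
      ∑ i, ‖Module.finBasis ℝ F i‖₊ • (μ.coordMeasure i).variation := by
    refine variation_le_of_forall_enorm_le fun s hs => ?_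
    rw [← sum_coordMeasure_smul μ s, Measure.finsetSum_apply]
    refine (enorm_sum_le _ _).trans (Finset.sum_le_sum fun i _ => ?_)
    rw [enorm_smul, mul_comm, Measure.smul_apply]
    exact mul_le_mul_right (enorm_measure_le_variation _ _) _
  exact isFiniteMeasure_of_le _ hle

/-- The Radon–Nikodym theorem for vector measures with values in a finite-dimensional space,
relative to their own variation. -/
theorem exists_density_variation [FiniteDimensional ℝ F] (μ : VectorMeasure X F) :
    ∃ h : X → F, Integrable h μ.variation ∧
      ∀ s, MeasurableSet s → ∫ x in s, h x ∂μ.variation = μ s := by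
  have hac (i) : μ.coordMeasure i ≪ᵥ μ.variation.toENNRealVectorMeasure := by
    refine AbsolutelyContinuous.mk fun s hs h0 => ?_
    rw [Measure.toENNRealVectorMeasure_apply_measurable hs] at h0
    have := enorm_measure_le_variation μ s
    rw [h0, nonpos_iff_eq_zero, enorm_eq_zero] at this
    rw [coordMeasure_apply, this]
    exact _root_.map_zero _
  let g := fun i => (μ.coordMeasure i).rnDeriv μ.variation
  have hg (i) : Integrable (g i) μ.variation := SignedMeasure.integrable_rnDeriv _ _
  refine ⟨fun x => ∑ i, g i x • Module.finBasis ℝ F i, ?_, fun s hs => ?_⟩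
  · exact integrable_finsetSum _ fun i _ => (hg i).smul_const _
  · rw [MeasureTheory.integral_finsetSum _ fun i _ => ((hg i).smul_const _).integrableOn,
      ← sum_coordMeasure_smul μ s]
    refine Finset.sum_congr rfl fun i _ => ?_
    rw [integral_smul_const]
    congr 1
    rw [← withDensityᵥ_apply (hg i) hs, SignedMeasure.withDensityᵥ_rnDeriv_eq _ _ (hac i)]

/-- Integration of a bounded function against a vector measure with density `h` with respect to
its variation. -/
theorem integral_eq_integral_density [CompleteSpace F] [CompleteSpace G]
    {μ : VectorMeasure X F} [IsFiniteMeasure μ.variation]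
    (B : E →L[ℝ] F →L[ℝ] G) {h : X → F} (hh : Integrable h μ.variation)
    (hμ : ∀ s, MeasurableSet s → ∫ x in s, h x ∂μ.variation = μ s)
    {f : X → E} (hf : StronglyMeasurable f) {C : ℝ} (hC : ∀ x, ‖f x‖ ≤ C) :
    μ.integral f B = ∫ x, B (f x) (h x) ∂μ.variation := by
  have hint (g : SimpleFunc X E) : Integrable (fun x => B (g x) (h x)) μ.variation := by
    obtain ⟨D, hD⟩ := g.exists_forall_norm_le
    refine (hh.norm.const_mul (‖B‖ * D)).mono'
      ((B.aestronglyMeasurable_comp₂ g.aestronglyMeasurable hh.aestronglyMeasurable)) ?_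
    refine .of_forall fun x => (B.le_opNorm₂ _ _).trans ?_
    gcongr
    exact hD x
  have hsimple (g : SimpleFunc X E) : μ.integral g B = ∫ x, B (g x) (h x) ∂μ.variation := by
    induction g using SimpleFunc.induction with
    | @const c s hs =>
      have e : (SimpleFunc.piecewise s hs (SimpleFunc.const X c) (SimpleFunc.const X 0) : X → E) =
          s.indicator fun _ => c := by
        ext x; simp [SimpleFunc.piecewise_apply, Set.indicator]
      have e2 : (fun x => B (s.indicator (fun _ => c) x) (h x)) =
          s.indicator fun x => B c (h x) := by
        ext x; by_cases hx : x ∈ s <;> simp [hx]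
      rw [e, e2, MeasureTheory.integral_indicator hs,
        (B c).integral_comp_comm hh.integrableOn, hμ s hs]
      rw [VectorMeasure.integral, setToFun_indicator_const _ hs (measure_ne_top _ _)]
      rfl
    | @add f g _ hf hg =>
      have i1 := f.integrable_of_isFiniteMeasure (μ := μ.variation)
      have i2 := g.integrable_of_isFiniteMeasure (μ := μ.variation)
      rw [SimpleFunc.coe_add, integral_add i1 i2, hf, hg,
        ← MeasureTheory.integral_add (hint f) (hint g)]
      simp
  -- Both sides pass to the limit along a uniformly bounded approximation by simple functions.
  let g := hf.approxBounded C
  have hg (x) : Filter.Tendsto (fun n => g n x) Filter.atTop (nhds (f x)) :=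
    hf.tendsto_approxBounded_of_norm_le (hC x)
  have hgC (n x) : ‖g n x‖ ≤ max C 0 :=
    (hf.norm_approxBounded_le ((norm_nonneg _).trans (hC x)) n x).trans (le_max_left _ _)
  have t1 : Filter.Tendsto (fun n => μ.integral (g n) B) Filter.atTop (nhds (μ.integral f B)) :=
    tendsto_integral_of_dominated_convergence (fun _ => max C 0)
      (fun n => (g n).aestronglyMeasurable) (integrable_const _)
      (fun n => .of_forall (hgC n)) (.of_forall hg)
  have t2 : Filter.Tendsto (fun n => ∫ x, B (g n x) (h x) ∂μ.variation) Filter.atTop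
      (nhds (∫ x, B (f x) (h x) ∂μ.variation)) := by
    refine MeasureTheory.tendsto_integral_of_dominated_convergence
      (fun x => ‖B‖ * max C 0 * ‖h x‖) (fun n => (hint (g n)).aestronglyMeasurable)
      (hh.norm.const_mul _) (fun n => .of_forall fun x => (B.le_opNorm₂ _ _).trans ?_)
      (.of_forall fun x => ?_)
    · gcongr
      exact hgC n x
    · exact ((B.flip (h x)).continuous.tendsto _).comp (hg x)
  simp only [hsimple] at t1
  exact tendsto_nhds_unique t1 t2

end MeasureTheory.VectorMeasure

/-! ### Uniqueness of the Fourier transform -/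

section FourierUniqueness

variable {V : Type*} [NormedAddCommGroup V] [InnerProductSpace ℝ V] [FiniteDimensional ℝ V]
  [MeasurableSpace V] [BorelSpace V]

omit [FiniteDimensional ℝ V] [MeasurableSpace V] [BorelSpace V] in
theorem norm_cexp_inner_mul_I (x ξ : V) : ‖Complex.exp (inner ℝ x ξ * Complex.I)‖ = 1 :=
  Complex.norm_exp_ofReal_mul_I _

theorem integrable_cexp_inner_smul {F : Type*} [NormedAddCommGroup F] [NormedSpace ℂ F]
    {ρ : Measure V} {h : V → F} (hh : Integrable h ρ) (ξ : V) :
    Integrable (fun x => Complex.exp (inner ℝ x ξ * Complex.I) • h x) ρ := by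
  refine hh.norm.mono' (AEStronglyMeasurable.smul (by fun_prop) hh.aestronglyMeasurable) ?_
  exact .of_forall fun x => by rw [norm_smul, norm_cexp_inner_mul_I, one_mul]

/-- The positive and the negative part of `g` give two finite measures with the same
characteristic function. -/
theorem ae_eq_zero_of_charFun_eq_zero_real {ρ : Measure V} {g : V → ℝ} (hg : Integrable g ρ)
    (h0 : ∀ ξ : V, ∫ x, Complex.exp (inner ℝ x ξ * Complex.I) * g x ∂ρ = 0) : g =ᵐ[ρ] 0 := by
  have hm : AEMeasurable g ρ := hg.aestronglyMeasurable.aemeasurable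
  have hmp : AEMeasurable (fun x => ENNReal.ofReal (g x)) ρ := by fun_prop
  have hmn : AEMeasurable (fun x => ENNReal.ofReal (-g x)) ρ := by fun_prop
  have f1 : IsFiniteMeasure (ρ.withDensity fun x => ENNReal.ofReal (g x)) :=
    isFiniteMeasure_withDensity_ofReal hg.2
  have f2 : IsFiniteMeasure (ρ.withDensity fun x => ENNReal.ofReal (-g x)) :=
    isFiniteMeasure_withDensity_ofReal hg.neg.2
  have key : (ρ.withDensity fun x => ENNReal.ofReal (g x)) =
      ρ.withDensity fun x => ENNReal.ofReal (-g x) := by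
    refine Measure.ext_of_charFun (funext fun ξ => ?_)
    rw [charFun_apply, charFun_apply, integral_withDensity_eq_integral_toReal_smul₀ hmp (by simp),
      integral_withDensity_eq_integral_toReal_smul₀ hmn (by simp), ← sub_eq_zero, ← integral_sub,
      ← h0 ξ]
    · refine integral_congr_ae (.of_forall fun x => ?_)
      simp only [Complex.real_smul, ENNReal.toReal_ofReal']
      rw [← sub_mul, ← Complex.ofReal_sub, max_zero_sub_max_neg_zero_eq_self, mul_comm]
    · exact (integrable_cexp_inner_smul (F := ℂ) hg.pos_part.ofReal ξ).congr
        (.of_forall fun x => by simp [ENNReal.toReal_ofReal', mul_comm])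
    · exact (integrable_cexp_inner_smul (F := ℂ) hg.neg_part.ofReal ξ).congr
        (.of_forall fun x => by simp [ENNReal.toReal_ofReal', mul_comm])
  have hfin : ∫⁻ x, ENNReal.ofReal (g x) ∂ρ ≠ ∞ := by
    have := f1.measure_univ_lt_top.ne
    rwa [withDensity_apply _ .univ, Measure.restrict_univ] at this
  filter_upwards [(withDensity_eq_iff hmp hmn hfin).1 key] with x hx
  rcases le_total 0 (g x) with h | h
  · rw [ENNReal.ofReal_of_nonpos (neg_nonpos.2 h), ENNReal.ofReal_eq_zero] at hx
    exact le_antisymm hx h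
  · rw [ENNReal.ofReal_of_nonpos h, eq_comm, ENNReal.ofReal_eq_zero] at hx
    exact le_antisymm h (neg_nonpos.1 hx)

theorem ae_eq_zero_of_charFun_eq_zero_complex {ρ : Measure V} {g : V → ℂ} (hg : Integrable g ρ)
    (h0 : ∀ ξ : V, ∫ x, Complex.exp (inner ℝ x ξ * Complex.I) * g x ∂ρ = 0) : g =ᵐ[ρ] 0 := by
  have hint {u : V → ℂ} (hu : Integrable u ρ) (ξ : V) :
      Integrable (fun x => Complex.exp (inner ℝ x ξ * Complex.I) * u x) ρ :=
    integrable_cexp_inner_smul hu ξ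
  have hgc : Integrable (fun x => starRingEnd ℂ (g x)) ρ :=
    Complex.conjLIE.integrable_comp_iff.2 hg
  have hc (ξ : V) : ∫ x, Complex.exp (inner ℝ x ξ * Complex.I) * starRingEnd ℂ (g x) ∂ρ = 0 := by
    rw [← map_zero (starRingEnd ℂ), ← h0 (-ξ), ← integral_conj]
    refine integral_congr_ae (.of_forall fun x => ?_)
    simp [← Complex.exp_conj]
  have hre : (fun x => (g x).re) =ᵐ[ρ] 0 := by
    refine ae_eq_zero_of_charFun_eq_zero_real hg.re fun ξ => ?_
    have : ∀ x, Complex.exp (inner ℝ x ξ * Complex.I) * ((g x).re : ℂ) = 2⁻¹ *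
        (Complex.exp (inner ℝ x ξ * Complex.I) * g x +
          Complex.exp (inner ℝ x ξ * Complex.I) * starRingEnd ℂ (g x)) := fun x => by
      rw [← mul_add, Complex.add_conj]; push_cast; ring
    simp_rw [this]
    rw [integral_const_mul, integral_add (hint hg ξ) (hint hgc ξ), h0, hc, add_zero, mul_zero]
  have him : (fun x => (g x).im) =ᵐ[ρ] 0 := by
    refine ae_eq_zero_of_charFun_eq_zero_real hg.im fun ξ => ?_
    have : ∀ x, Complex.exp (inner ℝ x ξ * Complex.I) * ((g x).im : ℂ) = (2 * Complex.I)⁻¹ *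
        (Complex.exp (inner ℝ x ξ * Complex.I) * g x -
          Complex.exp (inner ℝ x ξ * Complex.I) * starRingEnd ℂ (g x)) := fun x => by
      rw [← mul_sub, Complex.sub_conj]; push_cast; field_simp
    simp_rw [this]
    rw [integral_const_mul, integral_sub (hint hg ξ) (hint hgc ξ), h0, hc, sub_zero, mul_zero]
  filter_upwards [hre, him] with x h1 h2
  exact Complex.ext h1 h2

/-- Uniqueness of the Fourier transform of vector-valued densities. -/
theorem ae_eq_zero_of_charFun_eq_zero {F : Type*} [NormedAddCommGroup F] [NormedSpace ℂ F]
    [CompleteSpace F] [SecondCountableTopology F] {ρ : Measure V} {h : V → F} (hh : Integrable h ρ)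
    (h0 : ∀ ξ : V, ∫ x, Complex.exp (inner ℝ x ξ * Complex.I) • h x ∂ρ = 0) : h =ᵐ[ρ] 0 := by
  refine ae_eq_zero_of_forall_dual ℂ fun L => ?_
  refine ae_eq_zero_of_charFun_eq_zero_complex (g := fun x => L (h x)) (L.integrable_comp hh)
    fun ξ => ?_
  rw [← map_zero L, ← h0 ξ, ← L.integral_comp_comm (integrable_cexp_inner_smul hh ξ)]
  simp

end FourierUniqueness

/-! ### Gaussian mixtures and the Fourier transform -/

section Core

variable {A : Type*} [CStarAlgebra A]
variable {V : Type*} [NormedAddCommGroup V] [InnerProductSpace ℝ V] [FiniteDimensional ℝ V]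
  [MeasurableSpace V] [BorelSpace V]

/-- A density with positive integrals is almost everywhere nonnegative for the quadratic forms
`b ↦ φ (b^* a b)`; a countable dense set of `b` gives a common null set. -/
theorem ae_forall_conj_nonneg [PartialOrder A] [StarOrderedRing A] [SecondCountableTopology A]
    {T : Type*} [MeasurableSpace T] {τ : Measure T} {H : T → A} (hH : Integrable H τ)
    (hpos : ∀ s, MeasurableSet s → 0 ≤ ∫ t in s, H t ∂τ)
    (φ : A →L[ℝ] ℝ) (hφ : ∀ b, 0 ≤ φ (star b * b)) :
    ∀ᵐ t ∂τ, ∀ b, 0 ≤ φ (star b * H t * b) := by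
  have hb (b : A) : ∀ᵐ t ∂τ, 0 ≤ φ (star b * H t * b) := by
    let L : A →L[ℝ] ℝ := φ.comp (ContinuousLinearMap.mulLeftRight ℝ A (star b) b)
    refine ae_nonneg_of_forall_setIntegral_nonneg (L.integrable_comp hH) fun s hs _ => ?_
    change 0 ≤ ∫ t in s, L (H t) ∂τ
    rw [L.integral_comp_comm hH.integrableOn]
    obtain ⟨c, hc⟩ := CStarAlgebra.nonneg_iff_eq_star_mul_self.1 (hpos s hs)
    have := hφ (c * b)
    rw [hc]
    simpa [L, mul_assoc] using this
  filter_upwards [ae_all_iff.2 fun n => hb (TopologicalSpace.denseSeq A n)] with t ht b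
  refine (TopologicalSpace.denseRange_denseSeq A).induction_on
    (p := fun b => 0 ≤ φ (star b * H t * b)) b ?_ ht
  exact isClosed_le continuous_const (by fun_prop)

theorem integral_prod_star_mul_mul {X : Type*} [MeasurableSpace X] {ρ : Measure X} [SFinite ρ]
    {u v : X → A} (hu : Integrable u ρ) (hv : Integrable v ρ) (a : A) :
    ∫ p : X × X, star (u p.1) * a * v p.2 ∂(ρ.prod ρ) =
      star (∫ x, u x ∂ρ) * a * ∫ x, v x ∂ρ := by
  have hus : Integrable (fun y => star (u y)) ρ :=
    (starL' ℝ : A ≃L[ℝ] A).toContinuousLinearMap.integrable_comp hu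
  have hstar : star (∫ x, u x ∂ρ) = ∫ x, star (u x) ∂ρ :=
    ((starL' ℝ : A ≃L[ℝ] A).integral_comp_comm u).symm
  rw [hstar, ← integral_mul_const_of_integrable hus]
  exact integral_prod_bilin (ContinuousLinearMap.mul ℝ A) (hus.mul_const a) hv

omit [FiniteDimensional ℝ V] [MeasurableSpace V] [BorelSpace V] in
theorem star_cexp_smul_mul_mul (x y ξ : V) (a b c : A) :
    star (Complex.exp (inner ℝ y ξ * Complex.I) • b) * a *
      (Complex.exp (inner ℝ x ξ * Complex.I) • c) =
    Complex.exp (inner ℝ (x - y) ξ * Complex.I) • (star b * a * c) := by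
  simp only [star_smul, smul_mul_assoc, mul_smul_comm, smul_smul, inner_sub_left]
  congr 1
  rw [RCLike.star_def, ← Complex.exp_conj, ← Complex.exp_add]
  congr 1
  simp
  ring

theorem integral_gaussian_mul_cexp_inner (s : ℝ) (w : V) :
    ∫ ξ : V, (Real.exp (-‖ξ‖ ^ 2) : ℂ) * Complex.exp (inner ℝ w ((2 * s) • ξ) * Complex.I) =
      ((Real.pi ^ (Module.finrank ℝ V / 2 : ℝ) * Real.exp (-(s ^ 2 * ‖w‖ ^ 2)) : ℝ) : ℂ) := by
  have := GaussianFourier.integral_cexp_neg_mul_sq_norm_add (V := V) (b := 1) (by simp)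
    (2 * s * Complex.I) w
  rw [div_one] at this
  rw [Complex.ofReal_mul, Complex.ofReal_cpow Real.pi_pos.le]
  convert this using 3 with ξ
  · rw [Complex.ofReal_exp, ← Complex.exp_add, inner_smul_right]
    push_cast
    ring_nf
  · push_cast
    rfl
  · push_cast
    congr 1
    rw [mul_pow, mul_pow, Complex.I_sq]
    ring

theorem integrable_gaussian_cexp_smul {ρ : Measure V} [SFinite ρ] {h : V → A} (hh : Integrable h ρ)
    (a : A) (s : ℝ) :
    Integrable (fun p : V × V × V => Real.exp (-‖p.1‖ ^ 2) •
      (star (Complex.exp (inner ℝ p.2.1 ((2 * s) • p.1) * Complex.I) • h p.2.1) * a *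
        (Complex.exp (inner ℝ p.2.2 ((2 * s) • p.1) * Complex.I) • h p.2.2)))
      (volume.prod (ρ.prod ρ)) := by
  have hg : Integrable (fun ξ : V => Real.exp (-‖ξ‖ ^ 2)) := by
    have := (GaussianFourier.integrable_cexp_neg_mul_sq_norm_add (V := V) (b := 1)
      (by simp) 0 0).norm
    refine this.congr (.of_forall fun ξ => ?_)
    simp only [Complex.norm_exp]
    norm_cast
    simp
  have hhs : Integrable (fun y => star (h y)) ρ :=
    (starL' ℝ : A ≃L[ℝ] A).toContinuousLinearMap.integrable_comp hh
  have hp := hg.smul_prod ((hhs.mul_const a).mul_prod hh)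
  refine (hp.bdd_smul (φ := fun p : V × V × V =>
    Complex.exp (inner ℝ (p.2.2 - p.2.1) ((2 * s) • p.1) * Complex.I)) 1
    (by fun_prop) (.of_forall fun p => (norm_cexp_inner_mul_I _ _).le)).congr
      (.of_forall fun p => ?_)
  rw [Pi.smul_apply', smul_comm]
  exact congrArg _ (star_cexp_smul_mul_mul _ _ _ _ _ _).symm

/-- The Gaussian kernel is the Fourier transform of a Gaussian, so that its quadratic form is an
integral of the quadratic forms of the Fourier transform of `h`. -/
theorem integral_gaussian_smul_star_fourier {ρ : Measure V} [SFinite ρ] {h : V → A}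
    (hh : Integrable h ρ) (a : A) (s : ℝ) :
    ∫ ξ : V, Real.exp (-‖ξ‖ ^ 2) •
      (star (∫ x, Complex.exp (inner ℝ x ((2 * s) • ξ) * Complex.I) • h x ∂ρ) * a *
        ∫ x, Complex.exp (inner ℝ x ((2 * s) • ξ) * Complex.I) • h x ∂ρ) =
    Real.pi ^ (Module.finrank ℝ V / 2 : ℝ) • ∫ p : V × V,
      Real.exp (-(s ^ 2 * ‖p.1 - p.2‖ ^ 2)) • (star (h p.1) * a * h p.2) ∂(ρ.prod ρ) := by
  have hi := integrable_gaussian_cexp_smul hh a s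
  simp_rw [← integral_prod_star_mul_mul (integrable_cexp_inner_smul hh _)
    (integrable_cexp_inner_smul hh _)]
  simp_rw [← integral_smul]
  rw [integral_integral_swap hi]
  refine integral_congr_ae (.of_forall fun p => ?_)
  simp only [star_cexp_smul_mul_mul]
  simp_rw [← Complex.coe_smul, smul_smul]
  rw [integral_smul_const, integral_gaussian_mul_cexp_inner, norm_sub_rev, Complex.ofReal_mul]

theorem integrable_gaussian_smul_star_fourier {ρ : Measure V} [SFinite ρ] {h : V → A}
    (hh : Integrable h ρ) (a : A) (s : ℝ) :
    Integrable fun ξ : V => Real.exp (-‖ξ‖ ^ 2) •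
      (star (∫ x, Complex.exp (inner ℝ x ((2 * s) • ξ) * Complex.I) • h x ∂ρ) * a *
        ∫ x, Complex.exp (inner ℝ x ((2 * s) • ξ) * Complex.I) • h x ∂ρ) := by
  refine (integrable_gaussian_cexp_smul hh a s).integral_prod_left.congr (.of_forall fun ξ => ?_)
  simp only
  rw [integral_smul, integral_prod_star_mul_mul (integrable_cexp_inner_smul hh _)
    (integrable_cexp_inner_smul hh _)]

theorem continuous_fourier_smul {ρ : Measure V} {h : V → A} (hh : Integrable h ρ) :
    Continuous fun ξ : V => ∫ x, Complex.exp (inner ℝ x ξ * Complex.I) • h x ∂ρ := by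
  refine continuous_of_dominated (fun ξ => (integrable_cexp_inner_smul hh ξ).aestronglyMeasurable)
    (bound := fun x => ‖h x‖) (fun ξ => .of_forall fun x => ?_) hh.norm (.of_forall fun x => ?_)
  · rw [norm_smul, norm_cexp_inner_mul_I, one_mul]
  · fun_prop

theorem norm_exp_smul_le {F : Type*} [NormedAddCommGroup F] [NormedSpace ℝ F] (t : ℝ≥0) (r : ℝ)
    (a : F) : ‖Real.exp (-(t * r ^ 2)) • a‖ ≤ ‖a‖ := by
  rw [norm_smul, Real.norm_eq_abs, Real.abs_exp]
  exact mul_le_of_le_one_left (norm_nonneg _)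
    (Real.exp_le_one_iff.2 (neg_nonpos.2 (by positivity)))

section Mixture

variable {F : Type*} [NormedAddCommGroup F] [NormedSpace ℝ F] {τ : Measure ℝ≥0} {H : ℝ≥0 → F}

theorem integrable_exp_smul (hH : Integrable H τ) (r : ℝ) :
    Integrable (fun t : ℝ≥0 => Real.exp (-(t * r ^ 2)) • H t) τ :=
  hH.norm.mono' (AEStronglyMeasurable.smul (by fun_prop) hH.aestronglyMeasurable)
    (.of_forall fun t => norm_exp_smul_le t r (H t))

theorem norm_integral_exp_smul_le (hH : Integrable H τ) (r : ℝ) :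
    ‖∫ t : ℝ≥0, Real.exp (-(t * r ^ 2)) • H t ∂τ‖ ≤ ∫ t, ‖H t‖ ∂τ :=
  norm_integral_le_of_norm_le hH.norm (.of_forall fun t => norm_exp_smul_le t r (H t))

theorem continuous_integral_exp_smul (hH : Integrable H τ) :
    Continuous fun r : ℝ => ∫ t : ℝ≥0, Real.exp (-(t * r ^ 2)) • H t ∂τ :=
  continuous_of_dominated (fun r => (integrable_exp_smul hH r).aestronglyMeasurable)
    (fun r => .of_forall fun t => norm_exp_smul_le t r (H t)) hH.norm
    (.of_forall fun t => by fun_prop)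

end Mixture

theorem integrable_exp_smul_star_mul_mul {τ : Measure ℝ≥0} [SFinite τ] {ρ : Measure V} [SFinite ρ]
    {H : ℝ≥0 → A} (hH : Integrable H τ) {h : V → A} (hh : Integrable h ρ) :
    Integrable (fun p : ℝ≥0 × V × V => Real.exp (-(p.1 * ‖p.2.1 - p.2.2‖ ^ 2)) •
      (star (h p.2.1) * H p.1 * h p.2.2)) (τ.prod (ρ.prod ρ)) := by
  have hhs : Integrable (fun y => star (h y)) ρ :=
    (starL' ℝ : A ≃L[ℝ] A).toContinuousLinearMap.integrable_comp hh
  have h1 : Integrable (fun p : ℝ≥0 × V × V => star (h p.2.1) * H p.1 * h p.2.2)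
      (τ.prod (ρ.prod ρ)) := by
    have hm := ((hhs.aestronglyMeasurable.comp_fst (ν := ρ)).comp_snd (μ := τ)).mul
      (hH.aestronglyMeasurable.comp_fst (ν := ρ.prod ρ)) |>.mul
      ((hh.aestronglyMeasurable.comp_snd (μ := ρ)).comp_snd (μ := τ))
    refine (hH.norm.mul_prod (hh.norm.mul_prod hh.norm)).mono' hm (.of_forall fun p => ?_)
    refine norm_mul₃_le.trans (le_of_eq ?_)
    rw [norm_star]
    ring
  have hm : AEStronglyMeasurable (fun p : ℝ≥0 × V × V => Real.exp (-(p.1 * ‖p.2.1 - p.2.2‖ ^ 2)))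
      (τ.prod (ρ.prod ρ)) := by fun_prop
  exact h1.norm.mono' (hm.smul h1.aestronglyMeasurable)
    (.of_forall fun p => norm_exp_smul_le _ _ _)

/-- If the Gaussian mixture `∫ exp (-t ‖y - x‖²) H t dτ`, with a density `H` that is positive for
`φ`, annihilates `h`, then the values of the Fourier transform of `h` are isotropic for the
quadratic form `b ↦ φ (b^* M b)` of the mass `M` of the mixture away from `t = 0`. The point `0` is
left out because the Gaussian `exp (-t ‖·‖²)` degenerates there to a constant, which sees only one
frequency. -/
theorem fourier_isotropic_of_integral_eq_zero {τ : Measure ℝ≥0} [SFinite τ] {ρ : Measure V}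
    [SFinite ρ] {H : ℝ≥0 → A} (hH : Integrable H τ) {h : V → A} (hh : Integrable h ρ)
    (φ : A →L[ℝ] ℝ) (hpos : ∀ᵐ t ∂τ, ∀ b, 0 ≤ φ (star b * H t * b))
    (h0 : ∀ y, ∫ x, (∫ t : ℝ≥0, Real.exp (-(t * ‖y - x‖ ^ 2)) • H t ∂τ) * h x ∂ρ = 0) (ξ : V) :
    φ (star (∫ x, Complex.exp (inner ℝ x ξ * Complex.I) • h x ∂ρ) *
      (∫ t in Set.Ioi 0, H t ∂τ) * ∫ x, Complex.exp (inner ℝ x ξ * Complex.I) • h x ∂ρ) = 0 := by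
  set W : V → A := fun ξ => ∫ x, Complex.exp (inner ℝ x ξ * Complex.I) • h x ∂ρ with hW
  have hWc : Continuous W := continuous_fourier_smul hh
  have hF := integrable_exp_smul_star_mul_mul hH hh
  let J : ℝ≥0 → A := fun t => ∫ p : V × V,
    Real.exp (-(t * ‖p.1 - p.2‖ ^ 2)) • (star (h p.1) * H t * h p.2) ∂(ρ.prod ρ)
  have hJi : Integrable J τ := hF.integral_prod_left
  -- The integral over `t` first, then over the second variable, is the hypothesis `h0`.
  have hJ0 : ∫ t, J t ∂τ = 0 := by
    rw [integral_integral_swap hF, integral_prod _ hF.integral_prod_right]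
    refine integral_eq_zero_of_ae (.of_forall fun y => ?_)
    have hinner (x : V) : ∫ t : ℝ≥0, Real.exp (-(t * ‖y - x‖ ^ 2)) • (star (h y) * H t * h x) ∂τ =
        star (h y) * ((∫ t : ℝ≥0, Real.exp (-(t * ‖y - x‖ ^ 2)) • H t ∂τ) * h x) := by
      have hi := integrable_exp_smul hH ‖y - x‖
      rw [← integral_mul_const_of_integrable hi,
        ← integral_const_mul_of_integrable (hi.mul_const _)]
      simp only [mul_smul_comm, smul_mul_assoc, mul_assoc]
    simp only [hinner, Pi.zero_apply]
    have hi : Integrable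
        (fun x => (∫ t : ℝ≥0, Real.exp (-(t * ‖y - x‖ ^ 2)) • H t ∂τ) * h x) ρ := by
      have hc : Continuous fun x : V => ∫ t : ℝ≥0, Real.exp (-(t * ‖y - x‖ ^ 2)) • H t ∂τ :=
        (continuous_integral_exp_smul hH).comp (continuous_const.sub continuous_id).norm
      exact (hh.norm.const_mul (∫ t, ‖H t‖ ∂τ)).mono'
        (hc.aestronglyMeasurable.mul hh.aestronglyMeasurable) (.of_forall fun x =>
          (norm_mul_le _ _).trans (by gcongr; exact norm_integral_exp_smul_le hH _))
    rw [integral_const_mul_of_integrable hi, h0, mul_zero]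
  have hJφ (t : ℝ≥0) : Real.pi ^ (Module.finrank ℝ V / 2 : ℝ) * φ (J t) =
      ∫ ξ, Real.exp (-‖ξ‖ ^ 2) * φ (star (W ((2 * √t) • ξ)) * H t * W ((2 * √t) • ξ)) := by
    have := congrArg φ (integral_gaussian_smul_star_fourier hh (H t) √t)
    rw [← φ.integral_comp_comm (integrable_gaussian_smul_star_fourier hh (H t) √t)] at this
    simpa [J, hW, Real.sq_sqrt t.2] using this.symm
  have hnn (t : ℝ≥0) (ht : ∀ b, 0 ≤ φ (star b * H t * b)) (ξ : V) :
      0 ≤ Real.exp (-‖ξ‖ ^ 2) * φ (star (W ((2 * √t) • ξ)) * H t * W ((2 * √t) • ξ)) :=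
    mul_nonneg (Real.exp_nonneg _) (ht _)
  have hc : 0 < Real.pi ^ (Module.finrank ℝ V / 2 : ℝ) := by positivity
  have hJz : (fun t => φ (J t)) =ᵐ[τ] 0 := by
    rw [← integral_eq_zero_iff_of_nonneg_ae _ (φ.integrable_comp hJi),
      φ.integral_comp_comm hJi, hJ0, map_zero]
    filter_upwards [hpos] with t ht
    refine nonneg_of_mul_nonneg_right ?_ hc
    rw [hJφ]
    exact integral_nonneg (hnn t ht)
  have hz : ∀ᵐ t ∂τ.restrict (Set.Ioi 0), φ (star (W ξ) * H t * W ξ) = 0 := by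
    filter_upwards [ae_restrict_of_ae hpos, ae_restrict_of_ae hJz,
      ae_restrict_mem measurableSet_Ioi] with t ht htz ht0
    -- A continuous function that vanishes almost everywhere vanishes everywhere, and `t > 0`
    -- makes the dilation by `2√t` onto.
    have h1 := hJφ t
    rw [htz, Pi.zero_apply, mul_zero, eq_comm, integral_eq_zero_iff_of_nonneg (hnn t ht)] at h1
    · have hcont : Continuous fun ξ : V =>
          Real.exp (-‖ξ‖ ^ 2) * φ (star (W ((2 * √t) • ξ)) * H t * W ((2 * √t) • ξ)) := by
        fun_prop
      have h2 := congrFun (hcont.ae_eq_iff_eq volume continuous_zero |>.1 h1) ((2 * √t)⁻¹ • ξ)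
      have ht' : (2 * √(t : ℝ)) ≠ 0 := by
        have : (0 : ℝ) < t := ht0
        positivity
      rw [smul_inv_smul₀ ht'] at h2
      exact (mul_eq_zero.1 h2).resolve_left (Real.exp_ne_zero _)
    · simpa [hW] using φ.integrable_comp (integrable_gaussian_smul_star_fourier hh (H t) √t)
  let L : A →L[ℝ] ℝ := φ.comp (ContinuousLinearMap.mulLeftRight ℝ A (star (W ξ)) (W ξ))
  change L (∫ t in Set.Ioi 0, H t ∂τ) = 0
  rw [← L.integral_comp_comm hH.integrableOn]
  exact integral_eq_zero_of_ae hz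

end Core

/-! ### The trace functional on matrices -/

section MatrixTrace

variable {m : ℕ}

instance CStarMatrix.finiteDimensional_real :
    FiniteDimensional ℝ (CStarMatrix (Fin m) (Fin m) ℂ) :=
  Module.Finite.equiv (CStarMatrix.ofMatrixₗ : Matrix (Fin m) (Fin m) ℂ ≃ₗ[ℝ] _)

/-- The real part of the trace, a faithful positive functional on the matrix algebra. -/
noncomputable def CStarMatrix.reTrace (m : ℕ) : CStarMatrix (Fin m) (Fin m) ℂ →L[ℝ] ℝ :=
  LinearMap.toContinuousLinearMap
    { toFun := fun a => ∑ i, (a i i).re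
      map_add' := fun a b => by simp [Finset.sum_add_distrib]
      map_smul' := fun r a => by simp [Finset.mul_sum] }

theorem CStarMatrix.reTrace_star_mul_self (b : CStarMatrix (Fin m) (Fin m) ℂ) :
    reTrace m (star b * b) = ∑ i, ∑ j, ‖b j i‖ ^ 2 := by
  change ∑ i, ((star b * b) i i).re = _
  refine Finset.sum_congr rfl fun i _ => ?_
  rw [CStarMatrix.mul_apply, Complex.re_sum]
  refine Finset.sum_congr rfl fun j _ => ?_
  rw [CStarMatrix.star_apply, RCLike.star_def, ← Complex.normSq_eq_conj_mul_self,
    Complex.ofReal_re, Complex.normSq_eq_norm_sq]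

theorem CStarMatrix.reTrace_star_mul_self_nonneg (b : CStarMatrix (Fin m) (Fin m) ℂ) :
    0 ≤ reTrace m (star b * b) := by
  rw [reTrace_star_mul_self]
  positivity

theorem CStarMatrix.eq_zero_of_reTrace_star_mul_self {b : CStarMatrix (Fin m) (Fin m) ℂ}
    (hb : reTrace m (star b * b) = 0) : b = 0 := by
  rw [reTrace_star_mul_self,
    Finset.sum_eq_zero_iff_of_nonneg fun _ _ => Finset.sum_nonneg fun _ _ => by positivity] at hb
  ext j i
  have := (Finset.sum_eq_zero_iff_of_nonneg fun _ _ => by positivity).1 (hb i (Finset.mem_univ i))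
    j (Finset.mem_univ j)
  simpa using this

end MatrixTrace

/-- With `a = c^* c`, the hypothesis says that `φ` vanishes at `(c b)^* (c b)`. -/
theorem eq_zero_of_faithful_conj {A : Type*} [CStarAlgebra A] [PartialOrder A] [StarOrderedRing A]
    {φ : A →L[ℝ] ℝ} (hφ : ∀ b, φ (star b * b) = 0 → b = 0) {a b : A}
    (ha : IsStrictlyPositive a) (hb : φ (star b * a * b) = 0) : b = 0 := by
  obtain ⟨c, hc⟩ := CStarAlgebra.nonneg_iff_eq_star_mul_self.1 ha.nonneg
  have h1 : c * b = 0 := by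
    refine hφ _ ?_
    rw [← hb, hc, star_mul]
    simp only [mul_assoc]
  refine (ha.isUnit.mul_right_eq_zero).1 ?_
  rw [hc, mul_assoc, h1, mul_zero]

/-! ### The feature map -/

namespace PosDefKernel

variable {X A : Type*} [CStarAlgebra A] [PartialOrder A] [StarOrderedRing A]
  (k : PosDefKernel X A)

/-- The inner product with a fixed vector on the left, as a continuous linear map. -/
noncomputable def innerCLM (u : k.RKHM) : k.RKHM →L[ℝ] A :=
  AddMonoidHom.toRealLinearMap
    { toFun := fun v => inner A u v
      map_zero' := by
        have := k.inner_rightMul u 0 0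
        simpa using this
      map_add' := fun v w => by
        have hc (g : k.RKHM × k.RKHM × k.RKHM → k.RKHM) (hg : Continuous g) :
            Continuous fun p : k.RKHM × k.RKHM × k.RKHM => (inner A p.1 (g p) : A) :=
          k.continuous_inner.comp (continuous_fst.prodMk hg)
        refine k.denseRange_toRKHM.induction_on₃ (p := fun u v w => (inner A u (v + w) : A) =
          inner A u v + inner A u w) (isClosed_eq ?_ ?_) (fun u v w => ?_) u v w
        · exact hc (fun p => p.2.1 + p.2.2) (by fun_prop)
        · exact (hc (fun p => p.2.1) (by fun_prop)).add (hc (fun p => p.2.2) (by fun_prop))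
        · rw [← map_add]
          simp only [inner_toRKHM, inner_add_right] }
    (k.continuous_inner.comp (continuous_const.prodMk continuous_id))

theorem innerCLM_apply (u v : k.RKHM) : k.innerCLM u v = inner A u v := rfl

theorem norm_feature_sq (x : X) : ‖k.feature x‖ ^ 2 = ‖k x x‖ := by
  rw [norm_sq_rkhm, inner_feature]

theorem norm_feature_sub_sq (x y : X) :
    ‖k.feature x - k.feature y‖ ^ 2 = ‖k x x - k x y - (k y x - k y y)‖ := by
  rw [feature, feature, ← map_sub, norm_toRKHM, norm_sq]
  have hs : k.single x 1 - k.single y 1 = k.single x 1 + (-1 : ℂ) • k.single y 1 := by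
    rw [neg_smul, one_smul, sub_eq_add_neg]
  have hk (x y : X) : (inner A (k.single x 1) (k.single y 1) : A) = k x y := by
    rw [← inner_feature, feature, feature, inner_toRKHM]
  rw [hs]
  simp only [inner_add_left, inner_add_right, inner_smul_left, inner_smul_right, hk]
  congr 1
  simp
  abel

theorem continuous_feature [TopologicalSpace X]
    (hk : Continuous fun p : X × X => k p.1 p.2) : Continuous k.feature := by
  refine continuous_iff_continuousAt.2 fun y => ?_
  rw [ContinuousAt, tendsto_iff_norm_sub_tendsto_zero]
  have h1 : Continuous fun x => √‖k x x - k x y - (k y x - k y y)‖ := by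
    have c1 : Continuous fun x => k x x := hk.comp (continuous_id.prodMk continuous_id)
    have c2 : Continuous fun x => k x y := hk.comp (continuous_id.prodMk continuous_const)
    have c3 : Continuous fun x => k y x := hk.comp (continuous_const.prodMk continuous_id)
    exact ((c1.sub c2).sub (c3.sub continuous_const)).norm.sqrt
  have h2 := h1.tendsto y
  simp only [sub_self, norm_zero, Real.sqrt_zero] at h2
  refine h2.congr fun x => ?_
  rw [← norm_feature_sub_sq, Real.sqrt_sq (norm_nonneg _)]

/-- The reproducing property turns a null mean embedding into a family of null integrals. -/
theorem integral_kernel_mul_eq_zero [MeasurableSpace X] {ρ : Measure X} {h : X → A}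
    (hi : Integrable (fun x => k.rightMul (k.feature x) (h x)) ρ)
    (h0 : ∫ x, k.rightMul (k.feature x) (h x) ∂ρ = 0) (y : X) : ∫ x, k y x * h x ∂ρ = 0 := by
  have := (k.innerCLM (k.feature y)).integral_comp_comm hi
  rw [h0, map_zero] at this
  simpa only [innerCLM_apply, inner_rightMul, inner_feature] using this

end PosDefKernel

/-! ### Radial kernels -/

section Radial

variable {d : ℕ} {A : Type*} [CStarAlgebra A] [PartialOrder A] [StarOrderedRing A]
  [FiniteDimensional ℝ A] {k : PosDefKernel (EuclideanSpace ℝ (Fin d)) A} {η : VectorMeasure ℝ≥0 A}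

/-- A measure with null mean embedding is zero: its density has a null Fourier transform. -/
theorem eq_zero_of_integral_feature_eq_zero
    (hη : IsPositiveMeasure η) {H : ℝ≥0 → A} (hH : Integrable H η.variation)
    (hHη : ∀ s, MeasurableSet s → ∫ t in s, H t ∂η.variation = η s)
    (hk : ∀ x y, k x y = ∫ t : ℝ≥0, Real.exp (-(t * ‖x - y‖ ^ 2)) • H t ∂η.variation)
    (hpos : IsStrictlyPositive (η (Set.Ioi 0)))
    {φ : A →L[ℝ] ℝ} (hφ : ∀ b, 0 ≤ φ (star b * b)) (hφ0 : ∀ b, φ (star b * b) = 0 → b = 0)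
    {C : ℝ} (hcont : Continuous k.feature) (hC : ∀ x, ‖k.feature x‖ ≤ C)
    {ν : VectorMeasure (EuclideanSpace ℝ (Fin d)) A}
    (hν : ν.integral k.feature (k.rightMul.bilinearRestrictScalars ℝ) = 0) : ν = 0 := by
  have := FiniteDimensional.proper_real A
  obtain ⟨h, hh, hhν⟩ := ν.exists_density_variation
  have hsm : StronglyMeasurable k.feature := hcont.stronglyMeasurable
  rw [VectorMeasure.integral_eq_integral_density _ hh hhν hsm hC] at hν
  have hi : Integrable (fun x => k.rightMul (k.feature x) (h x)) ν.variation := by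
    refine (hh.norm.const_mul (‖k.rightMul‖ * C)).mono'
      (k.rightMul.aestronglyMeasurable_comp₂ hsm.aestronglyMeasurable hh.aestronglyMeasurable)
      (.of_forall fun x => (k.rightMul.le_opNorm₂ _ _).trans ?_)
    gcongr
    exact hC x
  have h0 := k.integral_kernel_mul_eq_zero hi hν
  simp only [hk] at h0
  have hHpos := ae_forall_conj_nonneg hH (fun s hs => (hHη s hs).symm ▸ hη s hs) φ hφ
  have hz := ae_eq_zero_of_charFun_eq_zero hh fun ξ =>
    eq_zero_of_faithful_conj hφ0 hpos <| by
      have := fourier_isotropic_of_integral_eq_zero hH hh φ hHpos h0 ξ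
      rwa [hHη _ measurableSet_Ioi] at this
  ext1 s hs
  rw [← hhν s hs, FunLike.coe_zero, Pi.zero_apply]
  exact integral_eq_zero_of_ae (ae_restrict_of_ae hz)

omit [StarOrderedRing A] [FiniteDimensional ℝ A] in
/-- A support point `t ≠ 0` has the open neighbourhood `(0, ∞)`. -/
theorem isStrictlyPositive_Ioi_of_measureSupport (hne : (measureSupport η).Nonempty)
    (hsupp : measureSupport η ≠ {0}) : IsStrictlyPositive (η (Set.Ioi 0)) := by
  obtain ⟨t, ht, ht0⟩ : ∃ t ∈ measureSupport η, t ≠ 0 := by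
    contrapose! hsupp
    exact Set.eq_singleton_iff_nonempty_unique_mem.2 ⟨hne, hsupp⟩
  exact ht _ isOpen_Ioi (pos_iff_ne_zero.2 ht0)

/-- Injectivity of the kernel mean embedding for radial kernels with values in a
finite-dimensional C⋆-algebra with a faithful positive functional `φ`. -/
theorem integrable_feature_and_kernelMeanEmbedding_injective
    {φ : A →L[ℝ] ℝ} (hφ : ∀ b, 0 ≤ φ (star b * b)) (hφ0 : ∀ b, φ (star b * b) = 0 → b = 0)
    (hη : IsPositiveMeasure η) (hk : IsRadialWith k η)
    (hne : (measureSupport η).Nonempty) (hsupp : measureSupport η ≠ {0}) :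
    (∀ μ : FiniteRegularMeasure (EuclideanSpace ℝ (Fin d)) A, μ.1.Integrable k.feature) ∧
    Function.Injective (kernelMeanEmbedding k) := by
  obtain ⟨H, hH, hHη⟩ := η.exists_density_variation
  have hk' (x y) : k x y = ∫ t : ℝ≥0, Real.exp (-(t * ‖x - y‖ ^ 2)) • H t ∂η.variation := by
    rw [hk x y]
    refine VectorMeasure.integral_eq_integral_density _ hH hHη
      (Continuous.stronglyMeasurable (by fun_prop)) (C := 1) fun t => ?_
    rw [Real.norm_eq_abs, Real.abs_exp]
    exact Real.exp_le_one_iff.2 (neg_nonpos.2 (by positivity))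
  have hcont : Continuous k.feature := by
    refine k.continuous_feature ?_
    simp only [hk']
    exact (continuous_integral_exp_smul hH).comp (continuous_fst.sub continuous_snd).norm
  have hC (x) : ‖k.feature x‖ ≤ √(∫ t, ‖H t‖ ∂η.variation) := by
    refine Real.le_sqrt_of_sq_le ?_
    rw [k.norm_feature_sq, hk']
    exact norm_integral_exp_smul_le hH _
  have hint (μ : VectorMeasure (EuclideanSpace ℝ (Fin d)) A) : μ.Integrable k.feature :=
    .of_bound hcont.aestronglyMeasurable _ (.of_forall hC)
  refine ⟨fun μ => hint μ.1, fun μ ν hμν => Subtype.ext (sub_eq_zero.1 ?_)⟩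
  refine eq_zero_of_integral_feature_eq_zero hη hH hHη hk'
    (isStrictlyPositive_Ioi_of_measureSupport hne hsupp) hφ hφ0 hcont hC ?_
  rw [VectorMeasure.integral_sub_vectorMeasure (hint _) (hint _)]
  exact sub_eq_zero.2 hμν

end Radial

theorem mainTheorem4 (m d : ℕ)
    (k : PosDefKernel (EuclideanSpace ℝ (Fin d)) (CStarMatrix (Fin m) (Fin m) ℂ))
    (η : VectorMeasure ℝ≥0 (CStarMatrix (Fin m) (Fin m) ℂ))
    (hη : IsPositiveMeasure η)
    (hk : IsRadialWith k η)
    (hne : (measureSupport η).Nonempty)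
    (hsupp : measureSupport η ≠ {0}) :
    (∀ μ : FiniteRegularMeasure (EuclideanSpace ℝ (Fin d)) (CStarMatrix (Fin m) (Fin m) ℂ),
      μ.1.Integrable k.feature) ∧
    Function.Injective (kernelMeanEmbedding k) := by
  -- The module structures of the matrix algebra and of its C⋆-algebra structure agree only after
  -- unfolding, so that the instance of finite dimension is passed explicitly.
  exact @integrable_feature_and_kernelMeanEmbedding_injective d _ _ _ _
    CStarMatrix.finiteDimensional_real k η (CStarMatrix.reTrace m)
    CStarMatrix.reTrace_star_mul_self_nonneg (fun _ => CStarMatrix.eq_zero_of_reTrace_star_mul_self)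
    hη hk hne hsupp
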